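/- Let $k \ge 2$ be an integer and let $\alpha$ be a real number such that $k^\alpha$ is irrational. Let $K$ be an integral domain of characteristic zero (for example $\mathbb{Z}$, $\mathbb{Q}$ or $\mathbb{C}$). For an integer $n \ge 0$ with standard base-$k$ representation $n = n_l \cdots n_1 n_0$, let $\tau(n) = x_{n_0} x_{n_1} \cdots x_{n_l}$ be the corresponding word in the non-commuting variables $x_0, \dots, x_{k-1}$ (with $\tau(0)$ the empty word), and let $$f(x_0, \dots, x_{k-1}) = \sum_{n \ge 0} \left\lfloor \alpha + \log_k(n+1) \right\rfloor \tau(n).$$ Let $f(x, \dots, x)$ be the power series in one variable obtained by setting $x_0 = \cdots = x_{k-1} = x$, and let $$g(x) = \sum_{m \ge 1} \left( \left\lfloor -k^{m+1-\mathrm{frac}(\alpha)} \right\rfloor - k \left\lfloor -k^{m-\mathrm{frac}(\alpha)} \right\rfloor \right) x^m, \qquad \mathrm{frac}(\alpha) = \alpha - \lfloor \alpha \rfloor .$$ A power series $s$ in non-commuting variables is called algebraic over $K$ if $s$ minus its constant term is a component of a solution $(s_1, \dots, s_r)$, by power series over $K$ without constant term, of a system $y_i = p_i$ $(1 \le i \le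 r)$, where each $p_i$ is a polynomial over $K$ in the non-commuting variables $x_0, \dots, x_{k-1}, y_1, \dots, y_r$ that has no constant term and no terms $c\,y_j$ with $c \in K$, $c \neq 0$. A power series in one variable $x$ is algebraic if it is a root of a nonzero polynomial with coefficients in $K[x]$. A sequence $(a(n))_{n \ge 0}$ is polynomial-recursive over $K$ if there are polynomials $p_0, \dots, p_d \in K[t]$, not all zero, with $\sum_{i=0}^d p_i(n)\, a(n+i) = 0$ for all $n \ge 0$. Then: 1. $f(x_0, \dots, x_{k-1})$ is not algebraic over $K$; 2. $f(x, \dots, x)$ is not algebraic; 3. the coefficient sequence of $g(x)$ takes only finitely many values, is not eventually periodic, and is not polynomial-recursive over $K$; 4. $g(x)$ is not algebraic. -/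

import Mathlib

/-- Formal power series with coefficients in `K` in the non-commuting variables `x_a`, `a : A`:
a series is the function that sends a word `w` over `A` to the coefficient of `w`. -/
def NCPowerSeries (A K : Type*) : Type _ := List A → K

namespace NCPowerSeries

variable {A K : Type*}

/-- The coefficient of the word `w`. -/
def coeff (w : List A) (f : NCPowerSeries A K) : K := f w

/-- The series with prescribed coefficients. -/
def mk (c : List A → K) : NCPowerSeries A K := c

@[simp] theorem coeff_mk (c : List A → K) (w : List A) : coeff w (mk c) = c w := rfl

@[ext] theorem ext {f g : NCPowerSeries A K} (h : ∀ w, coeff w f = coeff w g) : f = g := funext h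

/-- Removal of a first letter `a`. -/
def shift (a : A) (f : NCPowerSeries A K) : NCPowerSeries A K := mk fun w => coeff (a :: w) f

theorem coeff_shift (a : A) (w : List A) (f : NCPowerSeries A K) :
    coeff w (shift a f) = coeff (a :: w) f := rfl

variable [CommRing K]

instance : AddCommGroup (NCPowerSeries A K) := inferInstanceAs (AddCommGroup (List A → K))

instance : Module K (NCPowerSeries A K) := inferInstanceAs (Module K (List A → K))

@[simp] theorem coeff_add (w : List A) (f g : NCPowerSeries A K) :
    coeff w (f + g) = coeff w f + coeff w g := rfl

@[simp] theorem coeff_smul (w : List A) (c : K) (f : NCPowerSeries A K) :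
    coeff w (c • f) = c * coeff w f := rfl

@[simp] theorem coeff_zero (w : List A) : coeff w (0 : NCPowerSeries A K) = 0 := rfl

@[simp] theorem coeff_sub (w : List A) (f g : NCPowerSeries A K) :
    coeff w (f - g) = coeff w f - coeff w g := rfl

/-- The series `1`, that is, the empty word. -/
instance : One (NCPowerSeries A K) := ⟨mk fun w => if w.isEmpty then 1 else 0⟩

/-- The Cauchy product: the coefficient of `w` in `f * g` is the sum over all factorizations
`w = u v` of the coefficient of `u` in `f` times the coefficient of `v` in `g`. -/
instance : Mul (NCPowerSeries A K) :=
  ⟨fun f g => mk fun w =>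
    ∑ i ∈ Finset.range (w.length + 1), coeff (w.take i) f * coeff (w.drop i) g⟩

theorem coeff_mul (w : List A) (f g : NCPowerSeries A K) :
    coeff w (f * g) =
      ∑ i ∈ Finset.range (w.length + 1), coeff (w.take i) f * coeff (w.drop i) g := rfl

@[simp] theorem coeff_one_nil : coeff [] (1 : NCPowerSeries A K) = 1 := rfl

@[simp] theorem coeff_one_cons (a : A) (w : List A) :
    coeff (a :: w) (1 : NCPowerSeries A K) = 0 := rfl

@[simp] theorem coeff_mul_nil (f g : NCPowerSeries A K) :
    coeff [] (f * g) = coeff [] f * coeff [] g := by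
  simp [coeff_mul]

theorem coeff_mul_cons (a : A) (w : List A) (f g : NCPowerSeries A K) :
    coeff (a :: w) (f * g) = coeff [] f * coeff (a :: w) g + coeff w (shift a f * g) := by
  rw [coeff_mul, coeff_mul, List.length_cons, Finset.sum_range_succ', add_comm]
  simp [coeff_shift]

theorem shift_mul (a : A) (f g : NCPowerSeries A K) :
    shift a (f * g) = coeff [] f • shift a g + shift a f * g := by
  ext w
  simp [coeff_shift, coeff_mul_cons]

protected theorem add_mul' (f g h : NCPowerSeries A K) : (f + g) * h = f * h + g * h := by
  ext w
  simp [coeff_mul, add_mul, Finset.sum_add_distrib]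

protected theorem mul_add' (f g h : NCPowerSeries A K) : f * (g + h) = f * g + f * h := by
  ext w
  simp [coeff_mul, mul_add, Finset.sum_add_distrib]

protected theorem smul_mul' (c : K) (f g : NCPowerSeries A K) : (c • f) * g = c • (f * g) := by
  ext w
  simp [coeff_mul, mul_assoc, Finset.mul_sum]

protected theorem mul_smul' (c : K) (f g : NCPowerSeries A K) : f * (c • g) = c • (f * g) := by
  ext w
  simp [coeff_mul, mul_left_comm, Finset.mul_sum]

protected theorem zero_mul' (f : NCPowerSeries A K) : 0 * f = 0 := by
  ext w
  simp [coeff_mul]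

protected theorem mul_zero' (f : NCPowerSeries A K) : f * 0 = 0 := by
  ext w
  simp [coeff_mul]

protected theorem one_mul' (f : NCPowerSeries A K) : 1 * f = f := by
  ext w
  cases w with
  | nil => simp
  | cons a w =>
    have h : shift a (1 : NCPowerSeries A K) = 0 := rfl
    simp [coeff_mul_cons, h, NCPowerSeries.zero_mul']

protected theorem mul_one' (f : NCPowerSeries A K) : f * 1 = f := by
  ext w
  induction w generalizing f with
  | nil => simp
  | cons a w ih => rw [coeff_mul_cons, ih]; simp [coeff_shift]

protected theorem mul_assoc' (f g h : NCPowerSeries A K) : f * g * h = f * (g * h) := by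
  ext w
  induction w generalizing f with
  | nil => simp [mul_assoc]
  | cons a w ih =>
    rw [coeff_mul_cons, coeff_mul_cons, shift_mul, NCPowerSeries.add_mul', coeff_add,
      NCPowerSeries.smul_mul', coeff_smul, ih, coeff_mul_nil, coeff_mul_cons]
    ring

instance : Ring (NCPowerSeries A K) :=
  { (inferInstance : AddCommGroup (NCPowerSeries A K)) with
    one := 1
    mul := (· * ·)
    left_distrib := NCPowerSeries.mul_add'
    right_distrib := NCPowerSeries.add_mul'
    zero_mul := NCPowerSeries.zero_mul'
    mul_zero := NCPowerSeries.mul_zero'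
    mul_assoc := NCPowerSeries.mul_assoc'
    one_mul := NCPowerSeries.one_mul'
    mul_one := NCPowerSeries.mul_one' }

instance : Algebra K (NCPowerSeries A K) :=
  Algebra.ofModule NCPowerSeries.smul_mul' NCPowerSeries.mul_smul'

open Classical in
/-- The variable `x_a`. -/
noncomputable def X (a : A) : NCPowerSeries A K := mk fun w => if w = [a] then 1 else 0

/-- Polynomials over `K` in the non-commuting variables `x_a` (`a : A`) and `y_j` (`j : Y`):
finite `K`-linear combinations of words. -/
abbrev NCPolynomial (A Y K : Type*) [CommRing K] : Type _ := MonoidAlgebra K (FreeMonoid (A ⊕ Y))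

/-- Substitution of the series `s j` for the variables `y_j`. -/
noncomputable def evalAt {Y : Type*} (s : Y → NCPowerSeries A K) :
    NCPolynomial A Y K →ₐ[K] NCPowerSeries A K :=
  MonoidAlgebra.lift K (NCPowerSeries A K) (FreeMonoid (A ⊕ Y)) (FreeMonoid.lift (Sum.elim X s))

/-- The system `y_j = p j` is proper: no `p j` has a constant term or a term `c • y_i`. -/
def IsProperSystem {Y : Type*} (p : Y → NCPolynomial A Y K) : Prop :=
  ∀ j, (p j).coeff 1 = 0 ∧ ∀ i, (p j).coeff (FreeMonoid.of (Sum.inr i)) = 0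

/-- A series in non-commuting variables is algebraic over `K` if, up to its constant term, it is a
component of the solution, by series without constant term, of a proper algebraic system
`y_1 = p_1, …, y_n = p_n`. -/
def IsAlgebraic (f : NCPowerSeries A K) : Prop :=
  ∃ (n : ℕ) (p : Fin n → NCPolynomial A (Fin n) K) (s : Fin n → NCPowerSeries A K),
    IsProperSystem p ∧ (∀ j, coeff [] (s j) = 0) ∧ (∀ j, s j = evalAt s (p j)) ∧
      ∃ j, f - algebraMap K (NCPowerSeries A K) (coeff [] f) = s j

/-- The series `f(x, …, x)` in one variable: every variable `x_a` is replaced by `x`, so that the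
coefficient of `x ^ m` is the sum of the coefficients of all words of length `m`. -/
noncomputable def specialize [Fintype A] (f : NCPowerSeries A K) : PowerSeries K :=
  PowerSeries.mk fun m => ∑ v : Fin m → A, coeff (List.ofFn v) f

end NCPowerSeries

/-- The word `τ(n) = x_{n_0} x_{n_1} ⋯ x_{n_l}` of the base-`k` digits of `n`, least significant
digit first; `τ(0)` is the empty word. -/
def digitWord (k : ℕ) (hk : 2 ≤ k) (n : ℕ) : List (Fin k) :=
  (Nat.digits k n).pmap Fin.mk fun _ hd => Nat.digits_lt_base hk hd

theorem digitWord_injective (k : ℕ) (hk : 2 ≤ k) : Function.Injective (digitWord k hk) := by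
  intro m n h
  have key : ∀ n, (digitWord k hk n).map Fin.val = Nat.digits k n := by
    intro n
    simp [digitWord, List.map_pmap]
  exact Nat.digits_inj_iff.mp (by rw [← key m, ← key n, h])

/-- The series `∑ n, a n • τ(n)` in the `k` non-commuting variables `x_0, …, x_{k-1}`: the
coefficient of `w` is the sum of `a n` over the (at most one) `n` with `τ(n) = w`. -/
noncomputable def digitSeries {K : Type*} [CommRing K] (k : ℕ) (hk : 2 ≤ k) (a : ℕ → K) :
    NCPowerSeries (Fin k) K :=
  NCPowerSeries.mk fun w => ∑ᶠ (n : ℕ) (_ : digitWord k hk n = w), a n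

/-- The sum in `digitSeries` has no junk value: the coefficient of `τ(n)` is `a n`. -/
theorem coeff_digitSeries {K : Type*} [CommRing K] (k : ℕ) (hk : 2 ≤ k) (a : ℕ → K) (n : ℕ) :
    NCPowerSeries.coeff (digitWord k hk n) (digitSeries k hk a) = a n := by
  simp [digitSeries, (digitWord_injective k hk).eq_iff]

/-- `f(x_0, …, x_{k-1}) = ∑ n, ⌊α + log_k (n + 1)⌋ τ(n)`. -/
noncomputable def floorLogSeries (K : Type*) [CommRing K] (k : ℕ) (hk : 2 ≤ k) (α : ℝ) :
    NCPowerSeries (Fin k) K :=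
  digitSeries k hk fun n => ((⌊α + Real.logb (k : ℝ) ((n : ℝ) + 1)⌋ : ℤ) : K)

/-- The coefficient of `x ^ m` in `g(x)`, where
`g(x) = ∑_{m ≥ 1} (⌊-k ^ (m + 1 - frac α)⌋ - k ⌊-k ^ (m - frac α)⌋) x ^ m`. -/
noncomputable def gCoeff (k : ℕ) (α : ℝ) (m : ℕ) : ℤ :=
  if m = 0 then 0
  else ⌊-(k : ℝ) ^ ((m : ℝ) + 1 - Int.fract α)⌋ - (k : ℤ) * ⌊-(k : ℝ) ^ ((m : ℝ) - Int.fract α)⌋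

/-- A sequence is eventually periodic. -/
def EventuallyPeriodic {K : Type*} (a : ℕ → K) : Prop :=
  ∃ N p : ℕ, 0 < p ∧ ∀ n, N ≤ n → a (n + p) = a n

/-- A sequence is polynomial-recursive: it satisfies a nontrivial linear recurrence
`p_0(n) a(n) + ⋯ + p_d(n) a(n + d) = 0` with polynomial coefficients. -/
def PolynomialRecursive {K : Type*} [CommRing K] (a : ℕ → K) : Prop :=
  ∃ (d : ℕ) (p : ℕ → Polynomial K), p d ≠ 0 ∧
    ∀ n : ℕ, ∑ i ∈ Finset.range (d + 1), (p i).eval (n : K) * a (n + i) = 0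

/-! Everything reduces to the coefficients of `g`. Put `y_m = -k^(m - frac α)`, so that `y_(m+1) = k
y_m`. For `m ≥ 1` the coefficient of `x^m` in `g` is `⌊k y_m⌋ - k⌊y_m⌋ = k{y_m} - {y_(m+1)}`, a
bounded integer. If these integers had eventual period `p`, the bounded differences `{y_(m+p)} -
{y_m}` would be multiplied by `k` at each step, hence would vanish; then a nonzero integer multiple
of the irrational number `k^(-frac α)` would be an integer (`not_eventuallyPeriodic_gCoeff`).

A polynomial-recursive sequence with finitely many values satisfies a recurrence with constant
coefficients, hence is eventually periodic by pigeonhole. So `g` is not polynomial-recursive. An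
algebraic series generates a finite extension of the rational functions that is stable under `x
d/dx`; a linear dependence among its Euler derivatives is a polynomial recurrence for its
coefficients (`PolynomialRecursive.of_isAlgebraic`). So `g` is not algebraic.

Summing the coefficients of `f` over all `n` with `m + 1` digits gives `⌊y_(m+1)⌋` plus the
coefficients of a rational series (`sum_floor_add_logb`), so algebraicity of `f(x, …, x)` would pass
to `g`. Finally, equating the variables in a proper system gives a commutative system with
invertible Jacobian, so algebraicity of `f` would pass to `f(x, …, x)`
(`NCPowerSeries.IsAlgebraic.specialize`). -/

/-! ### Polynomial recurrences for sequences with finitely many values -/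

/-- Only finitely many windows `c = (a(n), …, a(n+d))` occur, and `n` is a root of `∑ c_i p_i` for
its window. A nonzero polynomial has finitely many roots, so for large `n` this polynomial vanishes
identically, and any one of its coefficients gives a constant recurrence. -/
theorem PolynomialRecursive.exists_constant_recurrence {K : Type*} [CommRing K] [IsDomain K]
    [CharZero K] {a : ℕ → K} (hfin : (Set.range a).Finite) (h : PolynomialRecursive a) :
    ∃ (d : ℕ) (q : ℕ → K) (N : ℕ), q d ≠ 0 ∧
      ∀ n, N ≤ n → ∑ i ∈ Finset.range (d + 1), q i * a (n + i) = 0 := by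
  obtain ⟨d, p, hd, h⟩ := h
  let P : (Fin (d + 1) → K) → Polynomial K := fun c => ∑ i : Fin (d + 1), p i * Polynomial.C (c i)
  let w : ℕ → Fin (d + 1) → K := fun n i => a (n + i)
  have hw : (Set.range w).Finite := by
    refine (Set.Finite.pi' (fun _ : Fin (d + 1) => hfin)).subset ?_
    rintro _ ⟨n, rfl⟩ i
    exact ⟨n + i, rfl⟩
  have heval : ∀ n, (P (w n)).eval (n : K) = 0 := by
    intro n
    rw [← h n, Finset.sum_range, Polynomial.eval_finsetSum]
    simp [w]
  have hB : {n | P (w n) ≠ 0}.Finite := by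
    have hU : (⋃ c ∈ {c ∈ Set.range w | P c ≠ 0}, {n : ℕ | (P c).IsRoot (n : K)}).Finite := by
      refine Set.Finite.biUnion (hw.subset (Set.sep_subset _ _)) fun c hc => ?_
      exact (Polynomial.finite_setOfPred_isRoot hc.2).preimage Nat.cast_injective.injOn
    refine hU.subset fun n hn => ?_
    simp only [Set.mem_iUnion]
    exact ⟨w n, ⟨⟨n, rfl⟩, hn⟩, heval n⟩
  obtain ⟨N, hN⟩ := hB.bddAbove
  -- The coefficient in degree `natDegree (p d)` is taken, so that `q d` is the leading coefficient
  -- of `p d`.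
  refine ⟨d, fun i => (p i).coeff (p d).natDegree, N + 1, by simpa using hd, fun n hn => ?_⟩
  have h0 : P (w n) = 0 := by
    by_contra h0
    have := hN h0
    omega
  have := congrArg (fun f => Polynomial.coeff f (p d).natDegree) h0
  simpa [P, w, Finset.sum_range, Polynomial.finsetSum_coeff] using this

/-- A polynomial-recursive sequence with finitely many values is eventually periodic. -/
theorem PolynomialRecursive.eventuallyPeriodic {K : Type*} [CommRing K] [IsDomain K]
    [CharZero K] {a : ℕ → K} (hfin : (Set.range a).Finite) (h : PolynomialRecursive a) :
    EventuallyPeriodic a := by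
  obtain ⟨d, q, N, hd, h⟩ := h.exists_constant_recurrence hfin
  have hw : (Set.pi Set.univ fun _ : Fin d => Set.range a).Finite := Set.Finite.pi fun _ => hfin
  have := hw.to_subtype
  let v : ℕ → Set.pi Set.univ fun _ : Fin d => Set.range a :=
    fun n => ⟨fun i => a (N + n + i), fun i _ => ⟨_, rfl⟩⟩
  -- Two windows of length `d` coincide by pigeonhole; as `q d ≠ 0` can be cancelled, a window
  -- determines all later terms.
  obtain ⟨n, m, hnm, hv⟩ : ∃ n m, n < m ∧ v n = v m := by
    obtain ⟨n, m, hnm, hv⟩ := Finite.exists_ne_map_eq_of_infinite v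
    rcases hnm.lt_or_gt with h | h
    exacts [⟨n, m, h, hv⟩, ⟨m, n, h, hv.symm⟩]
  have key : ∀ j, a (N + n + j) = a (N + m + j) := by
    intro j
    induction j using Nat.strong_induction_on with
    | _ j ih =>
      by_cases hj : j < d
      · exact congrFun (congrArg Subtype.val hv) ⟨j, hj⟩
      · have h1 := h (N + n + (j - d)) (by omega)
        have h2 := h (N + m + (j - d)) (by omega)
        rw [Finset.sum_range_succ] at h1 h2
        have h3 : ∑ i ∈ Finset.range d, q i * a (N + n + (j - d) + i) =
            ∑ i ∈ Finset.range d, q i * a (N + m + (j - d) + i) := by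
          refine Finset.sum_congr rfl fun i hi => ?_
          have hi := Finset.mem_range.mp hi
          have := ih (j - d + i) (by omega)
          rw [← add_assoc, ← add_assoc] at this
          rw [this]
        have e1 : N + n + (j - d) + d = N + n + j := by omega
        have e2 : N + m + (j - d) + d = N + m + j := by omega
        rw [e1, h3] at h1
        rw [e2] at h2
        exact mul_left_cancel₀ hd (by linear_combination h1 - h2)
  refine ⟨N + n, m - n, by omega, fun i hi => ?_⟩
  have := key (i - (N + n))
  rw [show N + n + (i - (N + n)) = i by omega,
    show N + m + (i - (N + n)) = i + (m - n) by omega] at this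
  exact this.symm
-- Algebraic power series have polynomial-recursive coefficients
-- `Q` is `P` with `θ` applied to its coefficients.
open Polynomial in
theorem Derivation.exists_apply_aeval_eq {R S : Type*} [CommRing R] [CommRing S] [Algebra R S]
    {B : Type*} [CommRing B] [Algebra B S] (θ : Derivation B S S) (hθ : ∀ r : R, ∃ r', θ (algebraMap R S r) = algebraMap R S r') (u : S)
    (P : R[X]) : ∃ Q : R[X], θ (aeval u P) = aeval u Q + aeval u (derivative P) * θ u := by
  induction P using Polynomial.induction_on' with
  | add p q hp hq =>
    obtain ⟨p', hp⟩ := hp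
    obtain ⟨q', hq⟩ := hq
    exact ⟨p' + q', by simp only [map_add, hp, hq]; ring⟩
  | monomial n r =>
    obtain ⟨r', hr⟩ := hθ r
    refine ⟨monomial n r', ?_⟩
    have hn : algebraMap R S (n : R) = n := _root_.map_natCast _ n
    simp only [aeval_monomial, Derivation.leibniz, Derivation.leibniz_pow, hr, smul_eq_mul,
      derivative_monomial, nsmul_eq_mul, _root_.map_mul, hn]
    ring

open Polynomial in
/-- Over a domain of characteristic zero, a nonzero annihilating polynomial of least degree is
separable at the root. -/
theorem IsAlgebraic.exists_aeval_derivative_ne_zero {R S : Type*} [CommRing R] [IsDomain R]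
    [CharZero R] [CommRing S] [Algebra R S] [FaithfulSMul R S] {u : S} (hu : IsAlgebraic R u) :
    ∃ P : R[X], aeval u P = 0 ∧ aeval u (derivative P) ≠ 0 := by
  classical
  have hex : ∃ n, ∃ P : R[X], P ≠ 0 ∧ aeval u P = 0 ∧ P.natDegree = n := by
    obtain ⟨P, h0, hP⟩ := hu
    exact ⟨_, P, h0, hP, rfl⟩
  obtain ⟨P, h0, hP, hn⟩ := Nat.find_spec hex
  refine ⟨P, hP, fun hd => ?_⟩
  have hdeg : P.natDegree ≠ 0 := by
    intro hdeg
    rw [Polynomial.eq_C_of_natDegree_eq_zero hdeg, aeval_C,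
      map_eq_zero_iff _ (FaithfulSMul.algebraMap_injective R S)] at hP
    exact h0 (by rw [Polynomial.eq_C_of_natDegree_eq_zero hdeg, hP, C_0])
  have hlt := Polynomial.natDegree_derivative_lt hdeg
  refine Nat.find_min hex (hn ▸ hlt) ⟨derivative P, fun h => hdeg ?_, hd, rfl⟩
  exact Polynomial.derivative_eq_zero.mp h

open Polynomial in
/-- If `θ` preserves a domain `R` of characteristic zero, an element that is algebraic over `R`
and its iterated derivatives are linearly dependent over `R`. -/
theorem IsAlgebraic.not_linearIndependent_iterate_derivation {R S : Type*} [CommRing R]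
    [IsDomain R] [CharZero R] [CommRing S] [IsDomain S] [Algebra R S] [FaithfulSMul R S]
    {B : Type*} [CommRing B] [Algebra B S] (θ : Derivation B S S) (hθ : ∀ r : R, ∃ r', θ (algebraMap R S r) = algebraMap R S r')
    {g : S} (hg : IsAlgebraic R g) : ¬ LinearIndependent R fun n : ℕ => θ^[n] g := by
  let F := FractionRing S
  let k := FractionRing R
  let : Algebra k F := FractionRing.liftAlgebra R F
  have : IsScalarTower R k F := FractionRing.isScalarTower_liftAlgebra R F
  have hinj : Function.Injective (algebraMap S F) := IsFractionRing.injective S F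
  -- `k(g)` is finite over `k`; being stable under `θ`, it contains every iterated derivative of
  -- `g`.
  let E : IntermediateField k F := IntermediateField.adjoin k {algebraMap S F g}
  have hR : ∀ r : R, algebraMap R F r ∈ E := fun r => by
    rw [IsScalarTower.algebraMap_apply R k F]
    exact E.algebraMap_mem _
  have haeval : ∀ (u : S) (P : R[X]), algebraMap S F u ∈ E → algebraMap S F (aeval u P) ∈ E := by
    intro u P hu
    induction P using Polynomial.induction_on' with
    | add p q hp hq => simpa using add_mem hp hq
    | monomial n r =>
      simpa [aeval_monomial, ← IsScalarTower.algebraMap_apply] using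
        mul_mem (hR r) (pow_mem hu n)
  have hint : IsIntegral k (algebraMap S F g) := by
    rw [← isAlgebraic_iff_isIntegral]
    exact (IsFractionRing.isAlgebraic_iff R k F).mp (hg.algebraMap (A := F))
  have : FiniteDimensional k E := IntermediateField.adjoin.finiteDimensional hint
  have : Algebra.IsAlgebraic k E := Algebra.IsAlgebraic.of_finite k E
  have hstep : ∀ u : S, algebraMap S F u ∈ E → algebraMap S F (θ u) ∈ E := by
    intro u hu
    have hualg : IsAlgebraic R u := by
      have h1 : IsAlgebraic k (algebraMap S F u) :=
        (Algebra.IsAlgebraic.isAlgebraic (R := k) (⟨_, hu⟩ : E)).algebraMap (A := F)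
      have h2 : IsAlgebraic R (algebraMap S F u) :=
        (IsFractionRing.isAlgebraic_iff R k F).mpr h1
      exact (isAlgebraic_algebraMap_iff hinj).mp h2
    -- Applying `θ` to `P(u) = 0` gives `θ u = -Q(u) / P'(u)`, which lies in `E`.
    obtain ⟨P, hP, hP'⟩ := hualg.exists_aeval_derivative_ne_zero
    obtain ⟨Q, hQ⟩ := θ.exists_apply_aeval_eq hθ u P
    rw [hP, map_zero] at hQ
    have hne : algebraMap S F (aeval u (derivative P)) ≠ 0 := by
      rwa [Ne, map_eq_zero_iff _ hinj]
    have : algebraMap S F (θ u) =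
        -algebraMap S F (aeval u Q) / algebraMap S F (aeval u (derivative P)) := by
      rw [eq_div_iff hne, ← map_mul, ← map_neg]
      congr 1
      linear_combination -hQ
    rw [this]
    exact div_mem (neg_mem (haeval u Q hu)) (haeval u _ hu)
  have hmem : ∀ n, algebraMap S F (θ^[n] g) ∈ E := by
    intro n
    induction n with
    | zero => exact IntermediateField.subset_adjoin _ _ rfl
    | succ n ih =>
      rw [Function.iterate_succ_apply']
      exact hstep _ ih
  intro hli
  have h1 : LinearIndependent R fun n : ℕ => algebraMap S F (θ^[n] g) :=
    hli.map' (IsScalarTower.toAlgHom R S F).toLinearMap (LinearMap.ker_eq_bot.mpr hinj)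
  have h2 : LinearIndependent k fun n : ℕ => algebraMap S F (θ^[n] g) :=
    (LinearIndependent.iff_fractionRing R k).mp h1
  have h3 : LinearIndependent k fun n : ℕ => (⟨_, hmem n⟩ : E) :=
    LinearIndependent.of_comp E.val.toLinearMap h2
  exact (inferInstance : Infinite ℕ).not_finite h3.finite

/-- The Euler derivation `x d/dx` on power series. -/
noncomputable def PowerSeries.eulerDerivation (K : Type*) [CommRing K] :
    Derivation K (PowerSeries K) (PowerSeries K) :=
  (PowerSeries.X (R := K)) • PowerSeries.derivative K

theorem PowerSeries.coeff_eulerDerivation {K : Type*} [CommRing K] (f : PowerSeries K) (n : ℕ) :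
    PowerSeries.coeff n (PowerSeries.eulerDerivation K f) = n * PowerSeries.coeff n f := by
  change PowerSeries.coeff n (PowerSeries.X * PowerSeries.derivative K f) = _
  cases n with
  | zero => simp
  | succ n =>
    rw [PowerSeries.coeff_succ_X_mul, PowerSeries.coeff_derivative]
    push_cast
    ring

theorem PowerSeries.coeff_eulerDerivation_iterate {K : Type*} [CommRing K] (f : PowerSeries K)
    (i n : ℕ) :
    PowerSeries.coeff n ((PowerSeries.eulerDerivation K)^[i] f) =
      (n : K) ^ i * PowerSeries.coeff n f := by
  induction i with
  | zero => simp
  | succ i ih =>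
    rw [Function.iterate_succ_apply', PowerSeries.coeff_eulerDerivation, ih]
    ring

theorem PowerSeries.eulerDerivation_coe {K : Type*} [CommRing K] (p : Polynomial K) :
    PowerSeries.eulerDerivation K (p : PowerSeries K) =
      ((Polynomial.X * Polynomial.derivative p : Polynomial K) : PowerSeries K) := by
  change PowerSeries.X * PowerSeries.derivative K _ = _
  rw [PowerSeries.derivative_coe]
  simp

instance PowerSeries.faithfulSMul_polynomial {K : Type*} [CommRing K] :
    FaithfulSMul (Polynomial K) (PowerSeries K) := by
  rw [faithfulSMul_iff_algebraMap_injective]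
  intro p q h
  exact Polynomial.coe_injective K (by simpa [PowerSeries.algebraMap_apply'] using h)

/-- The coefficients of an algebraic power series over a domain of characteristic zero form a
polynomial-recursive sequence. -/
theorem PolynomialRecursive.of_isAlgebraic {K : Type*} [CommRing K] [IsDomain K] [CharZero K]
    {g : PowerSeries K} (hg : IsAlgebraic (Polynomial K) g) :
    PolynomialRecursive fun n => PowerSeries.coeff n g := by
  classical
  have hli := hg.not_linearIndependent_iterate_derivation (PowerSeries.eulerDerivation K)
    fun r => ⟨Polynomial.X * Polynomial.derivative r, by
      simpa [PowerSeries.algebraMap_apply'] using PowerSeries.eulerDerivation_coe r⟩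
  rw [not_linearIndependent_iff] at hli
  obtain ⟨s, c, hsum, i₀, hi₀, hci₀⟩ := hli
  -- Since `θ^i` multiplies the `n`-th coefficient by `n^i`, the coefficient of `x^m` in `∑ c_i θ^i
  -- g` is `∑_j q_j(m - j) g_(m-j)`.
  let q : ℕ → Polynomial K := fun j => ∑ i ∈ s, Polynomial.C ((c i).coeff j) * Polynomial.X ^ i
  let J := s.sup fun i => (c i).natDegree
  have hqJ : ∀ j, J < j → q j = 0 := by
    intro j hj
    refine Finset.sum_eq_zero fun i hi => ?_
    rw [Polynomial.coeff_eq_zero_of_natDegree_lt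
      ((Finset.le_sup (f := fun i => (c i).natDegree) hi).trans_lt hj)]
    simp
  have hex : ∃ j, q j ≠ 0 := by
    refine ⟨(c i₀).natDegree, fun h => hci₀ ?_⟩
    have := congrArg (fun f => Polynomial.coeff f i₀) h
    simpa [q, Polynomial.finsetSum_coeff, Polynomial.coeff_X_pow, hi₀] using this
  have hrec : ∀ m, ∑ j ∈ Finset.range (m + 1),
      (q j).eval ((m - j : ℕ) : K) * PowerSeries.coeff (m - j) g = 0 := by
    intro m
    have h1 := congrArg (PowerSeries.coeff m) hsum
    rw [map_sum, map_zero] at h1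
    rw [← h1]
    simp only [q, Polynomial.eval_finsetSum, Finset.sum_mul]
    rw [Finset.sum_comm]
    refine Finset.sum_congr rfl fun i _ => ?_
    rw [Algebra.smul_def, PowerSeries.algebraMap_apply', PowerSeries.coeff_mul,
      Finset.Nat.sum_antidiagonal_eq_sum_range_succ_mk]
    refine Finset.sum_congr rfl fun j _ => ?_
    simp [PowerSeries.coeff_eulerDerivation_iterate, mul_assoc]
  set j₀ := Nat.find hex with hj₀
  have hne : q j₀ ≠ 0 := Nat.find_spec hex
  have hj₀J : j₀ ≤ J := by
    by_contra h
    exact hne (hqJ _ (by omega))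
  -- Substitute `m = n + J` and `t = J - j`, so that `m - j = n + t`. The least `j` with `q_j ≠ 0`
  -- yields the top term of the recurrence.
  refine ⟨J - j₀, fun t => (q (J - t)).comp (Polynomial.X + Polynomial.C (t : K)), ?_, fun n => ?_⟩
  · simp only [Nat.sub_sub_self hj₀J]
    rwa [Ne, Polynomial.comp_X_add_C_eq_zero_iff]
  · rw [← hrec (n + J)]
    refine Finset.sum_of_injOn (fun t => J - t) ?_ ?_ ?_ ?_
    · intro t ht t' ht' h
      simp only [Finset.coe_range, Set.mem_Iio] at ht ht' h
      omega
    · intro t ht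
      simp only [Finset.coe_range, Set.mem_Iio] at ht ⊢
      omega
    · intro j hj hj'
      have : q j = 0 := by
        rcases lt_or_ge J j with h | h
        · exact hqJ j h
        · by_contra hq
          have : j₀ ≤ j := Nat.find_min' hex hq
          refine hj' ⟨J - j, ?_, ?_⟩
          · simp only [Finset.coe_range, Set.mem_Iio]
            omega
          · exact Nat.sub_sub_self h
      rw [this, Polynomial.eval_zero, zero_mul]
    · intro t ht
      have ht := Finset.mem_range.mp ht
      have e : n + J - (J - t) = n + t := by omega
      simp [e]

/-! ### Floors of powers: the coefficients of `g` and the block sums of `f` -/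

section FloorDigits

variable {k : ℕ} {α : ℝ}

theorem rpow_sub_fract_eq (hk : 2 ≤ k) (m : ℝ) :
    (k : ℝ) ^ (m - Int.fract α) = (k : ℝ) ^ m * (k : ℝ) ^ (-Int.fract α) := by
  rw [sub_eq_add_neg, Real.rpow_add (by positivity)]

theorem irrational_rpow_neg_fract (hk : 2 ≤ k) (hα : Irrational ((k : ℝ) ^ α)) :
    Irrational ((k : ℝ) ^ (-Int.fract α)) := by
  have h : (k : ℝ) ^ (-Int.fract α) = (((k : ℚ) ^ ⌊α⌋ : ℚ) : ℝ) * ((k : ℝ) ^ α)⁻¹ := by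
    rw [Int.fract, neg_sub, Real.rpow_sub (by positivity), Real.rpow_intCast, div_eq_mul_inv]
    push_cast
    rfl
  rw [h]
  exact (irrational_inv_iff.mpr hα).ratCast_mul (by positivity)

theorem fract_pos_of_irrational_rpow (hα : Irrational ((k : ℝ) ^ α)) : 0 < Int.fract α := by
  rw [Int.fract_pos]
  intro h
  rw [h, Real.rpow_intCast] at hα
  exact hα ⟨(k : ℚ) ^ ⌊α⌋, by push_cast; rfl⟩

/-- The integer `⌊-k ^ (m - frac α)⌋`. -/
noncomputable def floorPow (k : ℕ) (α : ℝ) (m : ℕ) : ℤ := ⌊-(k : ℝ) ^ ((m : ℝ) - Int.fract α)⌋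

theorem gCoeff_eq_floorPow {m : ℕ} (hm : m ≠ 0) :
    gCoeff k α m = floorPow k α (m + 1) - k * floorPow k α m := by
  simp [gCoeff, floorPow, hm]

/-- With `y = -k^(m - frac α)`, the real numbers `ky` and `k · y` cancel in `⌊ky⌋ - k⌊y⌋`, and only
fractional parts remain. -/
theorem gCoeff_eq_fract (hk : 2 ≤ k) {m : ℕ} (hm : m ≠ 0) :
    (gCoeff k α m : ℝ) = k * Int.fract (-(k : ℝ) ^ ((m : ℝ) - Int.fract α)) -
      Int.fract (-(k : ℝ) ^ (((m + 1 : ℕ) : ℝ) - Int.fract α)) := by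
  have h : (k : ℝ) ^ (((m + 1 : ℕ) : ℝ) - Int.fract α) =
      k * (k : ℝ) ^ ((m : ℝ) - Int.fract α) := by
    rw [rpow_sub_fract_eq hk, rpow_sub_fract_eq hk, Real.rpow_natCast, Real.rpow_natCast, pow_succ]
    ring
  rw [gCoeff_eq_floorPow hm, floorPow, floorPow, ← Int.self_sub_floor (-(k : ℝ) ^ _),
    ← Int.self_sub_floor (-(k : ℝ) ^ _), h]
  push_cast
  ring

theorem finite_range_gCoeff (hk : 2 ≤ k) : (Set.range (gCoeff k α)).Finite := by
  refine (Set.finite_Icc (-1 : ℤ) k).subset ?_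
  rintro _ ⟨m, rfl⟩
  rcases eq_or_ne m 0 with rfl | hm
  · simp [gCoeff]
  · have h := gCoeff_eq_fract (α := α) hk hm
    have h1 := Int.fract_nonneg (-(k : ℝ) ^ ((m : ℝ) - Int.fract α))
    have h2 := Int.fract_lt_one (-(k : ℝ) ^ ((m : ℝ) - Int.fract α))
    have h3 := Int.fract_nonneg (-(k : ℝ) ^ (((m + 1 : ℕ) : ℝ) - Int.fract α))
    have h4 := Int.fract_lt_one (-(k : ℝ) ^ (((m + 1 : ℕ) : ℝ) - Int.fract α))
    have hk0 : (0 : ℝ) ≤ k := by positivity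
    constructor
    · have : ((-1 : ℤ) : ℝ) ≤ gCoeff k α m := by push_cast; nlinarith
      exact_mod_cast this
    · have : (gCoeff k α m : ℝ) ≤ (k : ℤ) := by push_cast; nlinarith
      exact_mod_cast this

/-- A bounded sequence that is eventually multiplied by `k ≥ 2` at each step vanishes. -/
theorem eq_zero_of_bounded_of_mul (hk : 2 ≤ k) {δ : ℕ → ℝ} {N : ℕ} (hb : ∀ n, |δ n| ≤ 1)
    (h : ∀ n, N ≤ n → δ (n + 1) = k * δ n) : δ N = 0 := by
  by_contra h0
  have hpow : ∀ j, δ (N + j) = (k : ℝ) ^ j * δ N := by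
    intro j
    induction j with
    | zero => simp
    | succ j ih => rw [← add_assoc, h _ (by omega), ih, pow_succ]; ring
  have hk1 : (1 : ℝ) < k := by exact_mod_cast hk
  obtain ⟨j, hj⟩ := pow_unbounded_of_one_lt (|δ N|⁻¹) hk1
  have h1 := hb (N + j)
  rw [hpow, abs_mul, abs_of_nonneg (by positivity)] at h1
  have h2 : 0 < |δ N| := abs_pos.mpr h0
  rw [inv_lt_iff_one_lt_mul₀ h2, mul_comm] at hj
  linarith

theorem not_eventuallyPeriodic_gCoeff (hk : 2 ≤ k) (hα : Irrational ((k : ℝ) ^ α)) :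
    ¬ EventuallyPeriodic (gCoeff k α) := by
  rintro ⟨N, p, hp, h⟩
  let φ : ℕ → ℝ := fun m => Int.fract (-(k : ℝ) ^ ((m : ℝ) - Int.fract α))
  have hφ : ∀ m, m ≠ 0 → φ (m + 1) = k * φ m - gCoeff k α m := fun m hm => by
    rw [gCoeff_eq_fract hk hm]
    ring
  have hδ : φ (N + 1 + p) - φ (N + 1) = 0 := by
    -- Starting at `N + 1` avoids the index `0`, where the coefficient of `g` is `0` by convention
    -- and `hφ` is not available.
    refine eq_zero_of_bounded_of_mul (δ := fun m => φ (m + p) - φ m) (N := N + 1) hk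
      (fun n => ?_) fun n hn => ?_
    · have h1 := Int.fract_nonneg (-(k : ℝ) ^ (((n + p : ℕ) : ℝ) - Int.fract α))
      have h2 := Int.fract_lt_one (-(k : ℝ) ^ (((n + p : ℕ) : ℝ) - Int.fract α))
      have h3 := Int.fract_nonneg (-(k : ℝ) ^ ((n : ℝ) - Int.fract α))
      have h4 := Int.fract_lt_one (-(k : ℝ) ^ ((n : ℝ) - Int.fract α))
      rw [abs_le]
      constructor <;> simp only [φ] <;> linarith
    · have h1 := hφ n (by omega)
      have h2 := hφ (n + p) (by omega)
      rw [h n (by omega)] at h2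
      simp only [add_right_comm n 1 p, h1, h2]
      ring
  have hint : ∃ z : ℤ, -(k : ℝ) ^ (((N + 1 + p : ℕ) : ℝ) - Int.fract α) -
      -(k : ℝ) ^ (((N + 1 : ℕ) : ℝ) - Int.fract α) = z :=
    Int.fract_eq_fract.mp (sub_eq_zero.mp hδ)
  obtain ⟨z, hz⟩ := hint
  rw [rpow_sub_fract_eq hk, rpow_sub_fract_eq hk, Real.rpow_natCast, Real.rpow_natCast] at hz
  have hlt : k ^ (N + 1) < k ^ (N + 1 + p) := Nat.pow_lt_pow_right (by omega) (by omega)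
  have hne : ((k : ℤ) ^ (N + 1) - (k : ℤ) ^ (N + 1 + p)) ≠ 0 := by
    have : (k : ℤ) ^ (N + 1) < (k : ℤ) ^ (N + 1 + p) := by exact_mod_cast hlt
    omega
  have hirr := (irrational_rpow_neg_fract hk hα).intCast_mul hne
  refine hirr ⟨z, ?_⟩
  push_cast
  rw [← hz]
  ring

/-- The sum of `⌊α + log_k (n + 1)⌋` over all `n` with `m` digits. -/
theorem sum_floor_add_logb (hk : 2 ≤ k) (hα : Irrational ((k : ℝ) ^ α)) (m : ℕ) :
    ∑ n ∈ Finset.Ico (k ^ m) (k ^ (m + 1)), ⌊α + Real.logb (k : ℝ) ((n : ℝ) + 1)⌋ =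
      ((k : ℤ) ^ (m + 1) - (k : ℤ) ^ m) * (⌊α⌋ + m) + (k : ℤ) ^ (m + 1) + 1 +
        floorPow k α (m + 1) := by
  have hk1 : (1 : ℝ) < k := by exact_mod_cast hk
  have hfr := fract_pos_of_irrational_rpow hα
  have hfr1 := Int.fract_lt_one α
  -- `x` is the threshold at which the floor jumps: on this block it equals `⌊α⌋ + m`, increased by
  -- one exactly when `n + 1 ≥ x`.
  set x : ℝ := (k : ℝ) ^ (((m + 1 : ℕ) : ℝ) - Int.fract α) with hx
  have hxlow : ((k ^ m : ℕ) : ℝ) < x := by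
    push_cast
    rw [← Real.rpow_natCast, hx]
    apply Real.rpow_lt_rpow_of_exponent_lt hk1
    push_cast
    linarith
  have hxup : x < ((k ^ (m + 1) : ℕ) : ℝ) := by
    push_cast
    rw [← Real.rpow_natCast, hx]
    apply Real.rpow_lt_rpow_of_exponent_lt hk1
    linarith
  have hterm : ∀ n ∈ Finset.Ico (k ^ m) (k ^ (m + 1)),
      ⌊α + Real.logb (k : ℝ) ((n : ℝ) + 1)⌋ =
        ⌊α⌋ + m + if ⌈x⌉₊ ≤ n + 1 then 1 else 0 := by
    intro n hn
    rw [Finset.mem_Ico] at hn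
    have hn0 : (0 : ℝ) < (n : ℝ) + 1 := by positivity
    have hlow : (m : ℝ) ≤ Real.logb k ((n : ℝ) + 1) := by
      rw [Real.le_logb_iff_rpow_le hk1 hn0, Real.rpow_natCast]
      have : k ^ m ≤ n + 1 := by omega
      exact_mod_cast this
    have hup : Real.logb k ((n : ℝ) + 1) ≤ m + 1 := by
      rw [Real.logb_le_iff_le_rpow hk1 hn0]
      have : n + 1 ≤ k ^ (m + 1) := hn.2
      have h2 : ((n : ℝ) + 1) ≤ (k : ℝ) ^ (m + 1) := by exact_mod_cast this
      rwa [← Real.rpow_natCast, Nat.cast_add, Nat.cast_one] at h2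
    have hiff : ⌈x⌉₊ ≤ n + 1 ↔ (m : ℝ) + 1 - Int.fract α ≤ Real.logb k ((n : ℝ) + 1) := by
      rw [Nat.ceil_le, Real.le_logb_iff_rpow_le hk1 hn0, hx]
      push_cast
      rfl
    have hα' := Int.floor_add_fract α
    rw [Int.floor_eq_iff]
    split_ifs with h
    · have := hiff.mp h
      push_cast
      constructor <;> linarith
    · have := not_le.mp (mt hiff.mpr h)
      push_cast
      constructor <;> linarith
  rw [Finset.sum_congr rfl hterm, Finset.sum_add_distrib, Finset.sum_const, Nat.card_Ico,
    Finset.sum_boole]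
  have hclow : k ^ m < ⌈x⌉₊ := Nat.lt_ceil.mpr hxlow
  have hcup : ⌈x⌉₊ ≤ k ^ (m + 1) := Nat.ceil_le.mpr hxup.le
  -- The jump occurs for `k^(m+1) + 1 - ⌈x⌉` values of `n`, and `-⌈x⌉ = ⌊-x⌋`.
  have hfilter : (Finset.Ico (k ^ m) (k ^ (m + 1))).filter (fun n => ⌈x⌉₊ ≤ n + 1) =
      Finset.Ico (⌈x⌉₊ - 1) (k ^ (m + 1)) := by
    ext n
    simp only [Finset.mem_filter, Finset.mem_Ico]
    omega
  have hfloor : floorPow k α (m + 1) = -(⌈x⌉₊ : ℤ) := by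
    rw [floorPow, Int.floor_neg, hx, Int.natCast_ceil_eq_ceil (by positivity)]
  rw [hfilter, Nat.card_Ico, hfloor, nsmul_eq_mul, Nat.cast_sub (by omega : k ^ m ≤ k ^ (m + 1)),
    Nat.cast_sub (by omega : ⌈x⌉₊ - 1 ≤ k ^ (m + 1)), Nat.cast_sub (by omega : 1 ≤ ⌈x⌉₊)]
  push_cast
  ring

end FloorDigits

/-! ### Equating the variables in a digit series -/

theorem digitWord_length (k : ℕ) (hk : 2 ≤ k) (n : ℕ) :
    (digitWord k hk n).length = (Nat.digits k n).length := by
  simp [digitWord]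

/-- The coefficient of `x ^ (m + 1)` in `f(x, …, x)` is the sum of `a n` over the `n` with `m + 1`
digits. -/
theorem coeff_specialize_digitSeries {K : Type*} [CommRing K] (k : ℕ) (hk : 2 ≤ k) (a : ℕ → K)
    (m : ℕ) :
    PowerSeries.coeff (m + 1) (NCPowerSeries.specialize (digitSeries k hk a)) =
      ∑ n ∈ Finset.Ico (k ^ m) (k ^ (m + 1)), a n := by
  classical
  have hlen : ∀ n, (digitWord k hk n).length = m + 1 ↔ n ∈ Finset.Ico (k ^ m) (k ^ (m + 1)) := by
    intro n
    rw [digitWord_length, Finset.mem_Ico, ← Nat.lt_digits_length_iff hk,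
      ← Nat.digits_length_le_iff hk]
    omega
  -- A word ending in the letter `0` is no `τ(n)`; both sides are then zero.
  have hcoeff : ∀ v : Fin (m + 1) → Fin k,
      NCPowerSeries.coeff (List.ofFn v) (digitSeries k hk a) =
        ∑ n ∈ Finset.Ico (k ^ m) (k ^ (m + 1)),
          if digitWord k hk n = List.ofFn v then a n else 0 := by
    intro v
    rw [digitSeries, NCPowerSeries.coeff_mk, finsum_eq_sum_of_support_subset]
    · exact Finset.sum_congr rfl fun n _ => finsum_eq_if
    · intro n hn
      rw [Finset.mem_coe, ← hlen]
      rw [Function.mem_support, finsum_eq_if] at hn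
      have : digitWord k hk n = List.ofFn v := by
        by_contra h
        exact hn (if_neg h)
      rw [this, List.length_ofFn]
  rw [NCPowerSeries.specialize, PowerSeries.coeff_mk, Finset.sum_congr rfl fun v _ => hcoeff v,
    Finset.sum_comm]
  refine Finset.sum_congr rfl fun n hn => ?_
  have hl := (hlen n).mpr hn
  obtain ⟨v, hv⟩ : ∃ v : Fin (m + 1) → Fin k, List.ofFn v = digitWord k hk n := by
    rw [← hl]
    exact ⟨_, List.ofFn_get _⟩
  rw [Finset.sum_eq_single v]
  · rw [if_pos hv.symm]
  · intro u _ hu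
    refine if_neg fun h => hu (List.ofFn_injective ?_)
    rw [hv, h]
  · simp
-- The Jacobian criterion for algebraicity
open MvPolynomial in
/-- The chain rule for derivations that vanish on the coefficients. -/
theorem Derivation.apply_mvPolynomial_aeval {R B : Type*} [CommRing R] [CommRing B] [Algebra R B]
    {ι : Type*} [Fintype ι] (D : Derivation R B B) (τ : ι → B) (P : MvPolynomial ι R) :
    D (aeval τ P) = ∑ i, aeval τ (pderiv i P) * D (τ i) := by
  classical
  induction P using MvPolynomial.induction_on with
  | C r => simp
  | add p q hp hq => simp [hp, hq, add_mul, Finset.sum_add_distrib]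
  | mul_X p j hp =>
    simp only [map_mul, aeval_X, Derivation.leibniz, hp, smul_eq_mul, pderiv_X, map_add, add_mul,
      Finset.sum_add_distrib, Finset.mul_sum]
    congr 1
    · rw [Finset.sum_eq_single j]
      · simp
      · intro i _ hij
        simp [hij.symm]
      · simp
    · exact Finset.sum_congr rfl fun i _ => by ring

/-- A field extension without nonzero derivations is formally unramified. -/
theorem Algebra.FormallyUnramified.of_forall_derivation_eq_zero {k L : Type*} [Field k] [Field L]
    [Algebra k L] (h : ∀ D : Derivation k L L, D = 0) : Algebra.FormallyUnramified k L := by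
  have hD : ∀ x : L, KaehlerDifferential.D k L x = 0 := by
    intro x
    -- Linear forms separate the points of a vector space, and a linear form on the differentials is
    -- a derivation `L → L`.
    rw [← Module.forall_dual_apply_eq_zero_iff L]
    intro φ
    exact DFunLike.congr_fun (h (φ.compDer (KaehlerDifferential.D k L))) x
  refine ⟨?_⟩
  rw [← Submodule.subsingleton_iff L, ← subsingleton_iff_bot_eq_top,
    ← KaehlerDifferential.span_range_derivation k L, eq_comm, Submodule.span_eq_bot]
  rintro _ ⟨x, rfl⟩
  exact hD x

open MvPolynomial in
/-- A solution of a square polynomial system at which the Jacobian determinant does not vanish is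
algebraic, in characteristic zero. -/
theorem isAlgebraic_of_jacobian_ne_zero {R S : Type*} [CommRing R] [IsDomain R] [CharZero R]
    [CommRing S] [IsDomain S] [Algebra R S] [FaithfulSMul R S] {ι : Type*} [Fintype ι]
    [DecidableEq ι] (Q : ι → MvPolynomial ι R) (σ : ι → S) (hQ : ∀ j, aeval σ (Q j) = 0)
    (hdet : (Matrix.of fun j i => aeval σ (pderiv i (Q j))).det ≠ 0) (j : ι) :
    IsAlgebraic R (σ j) := by
  let F := FractionRing S
  let k := FractionRing R
  let : Algebra k F := FractionRing.liftAlgebra R F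
  have : IsScalarTower R k F := FractionRing.isScalarTower_liftAlgebra R F
  have hinj : Function.Injective (algebraMap S F) := IsFractionRing.injective S F
  have : CharZero k := charZero_of_injective_algebraMap (IsFractionRing.injective R k)
  let L : IntermediateField k F := IntermediateField.adjoin k (Set.range fun j => algebraMap S F (σ j))
  have : IsScalarTower R L F := .of_algebraMap_eq fun _ => rfl
  let τ : ι → L := fun j => ⟨algebraMap S F (σ j), IntermediateField.subset_adjoin _ _ ⟨j, rfl⟩⟩
  have haev : ∀ P : MvPolynomial ι R,
      algebraMap L F (aeval τ P) = algebraMap S F (aeval σ P) := by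
    intro P
    rw [← aeval_algebraMap_apply, ← aeval_algebraMap_apply]
    rfl
  have hLinj : Function.Injective (algebraMap L F) := (algebraMap L F).injective
  have : Algebra.EssFiniteType k L :=
    IntermediateField.essFiniteType_iff.mpr
      (IntermediateField.fg_adjoin_of_finite (Set.finite_range _))
  -- Differentiating `Q_j(τ) = 0` shows that the Jacobian matrix kills the vector `(D τ_i)`; so `D`
  -- vanishes on generators of `L`.
  have hder : ∀ D : Derivation k L L, D = 0 := by
    intro D
    have hτ : (fun i => D (τ i)) = 0 := by
      refine Matrix.eq_zero_of_mulVec_eq_zero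
        (M := Matrix.of fun j i => aeval τ (pderiv i (Q j))) ?_ ?_
      · intro h0
        apply hdet
        apply hinj
        rw [RingHom.map_det, map_zero, ← map_zero (algebraMap L F), ← h0, RingHom.map_det]
        congr 1
        ext a b
        simp [haev]
      · funext a
        have h1 := (D.restrictScalars R).apply_mvPolynomial_aeval τ (Q a)
        have h2 : aeval τ (Q a) = 0 := hLinj (by rw [haev, hQ, map_zero, map_zero])
        rw [h2, map_zero] at h1
        simpa [Matrix.mulVec, dotProduct] using h1.symm
    ext x
    obtain ⟨x, hx⟩ := x
    rw [Derivation.zero_apply]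
    congr 1
    induction hx using IntermediateField.adjoin_induction with
    | mem x hx =>
      obtain ⟨j, rfl⟩ := hx
      exact congrFun hτ j
    | algebraMap x => exact D.map_algebraMap x
    | add x y hx hy h1 h2 =>
      have : (⟨x + y, add_mem hx hy⟩ : L) = ⟨x, hx⟩ + ⟨y, hy⟩ := rfl
      rw [this, map_add, h1, h2, add_zero]
    | inv x hx h =>
      have : (⟨x⁻¹, inv_mem hx⟩ : L) = ⟨x, hx⟩⁻¹ := rfl
      rw [this, Derivation.leibniz_inv, h, smul_zero]
    | mul x y hx hy h1 h2 =>
      have : (⟨x * y, mul_mem hx hy⟩ : L) = ⟨x, hx⟩ * ⟨y, hy⟩ := rfl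
      rw [this, Derivation.leibniz, h1, h2, smul_zero, smul_zero, add_zero]
  have := Algebra.FormallyUnramified.of_forall_derivation_eq_zero hder
  -- A finitely generated unramified field extension is separable algebraic.
  have := Algebra.FormallyUnramified.isSeparable k L
  have h1 : IsAlgebraic k (algebraMap S F (σ j)) :=
    (Algebra.IsAlgebraic.isAlgebraic (R := k) (τ j)).algebraMap (A := F)
  exact (isAlgebraic_algebraMap_iff hinj).mp ((IsFractionRing.isAlgebraic_iff R k F).mpr h1)

/-! ### From non-commuting variables to one variable -/

namespace NCPowerSeries

/-- The commutative polynomial obtained by replacing all `x_a` by `x`. -/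
noncomputable def commPolynomial (A Y K : Type*) [CommRing K] :
    NCPolynomial A Y K →ₐ[K] MvPolynomial Y (Polynomial K) :=
  MonoidAlgebra.lift K _ (FreeMonoid (A ⊕ Y))
    (FreeMonoid.lift (Sum.elim (fun _ => MvPolynomial.C Polynomial.X) MvPolynomial.X))

/-- At a point without constant term, the constant coefficient of the derivative of a
non-commutative polynomial with respect to `y_i` is the coefficient of `y_i`. -/
theorem constantCoeff_aeval_pderiv_commPolynomial {A Y K : Type*} [CommRing K] (σ : Y → PowerSeries K)
    (hσ : ∀ j, PowerSeries.constantCoeff (σ j) = 0) (p : NCPolynomial A Y K) (i : Y) :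
    PowerSeries.constantCoeff (MvPolynomial.aeval σ
      (MvPolynomial.pderiv i (commPolynomial A Y K p))) =
        p.coeff (FreeMonoid.of (Sum.inr i)) := by
  classical
  have hletter : ∀ x : A ⊕ Y, PowerSeries.constantCoeff (MvPolynomial.aeval σ (Sum.elim
      (fun _ : A => MvPolynomial.C (Polynomial.X : Polynomial K)) MvPolynomial.X x)) = 0 := by
    rintro (a | j)
    · simp [PowerSeries.algebraMap_apply']
    · simp [hσ]
  induction p using MonoidAlgebra.induction_on with
  | of w =>
    cases w using FreeMonoid.casesOn with
    | one => simp [commPolynomial]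
    | of_mul x w =>
      cases w using FreeMonoid.casesOn with
      | one =>
        rcases x with a | j
        · simp [commPolynomial, FreeMonoid.of_injective.eq_iff]
        · simp only [commPolynomial, mul_one, MonoidAlgebra.of_apply, MonoidAlgebra.lift_single,
            FreeMonoid.lift_eval_of, Sum.elim_inr, one_smul, MvPolynomial.pderiv_X,
            MonoidAlgebra.coeff_single, Finsupp.single_apply, Pi.single_apply,
            FreeMonoid.of_injective.eq_iff, Sum.inr.injEq]
          split_ifs <;> simp
      | of_mul y w =>
        -- In a word of length at least two, each term of the product rule keeps a letter, whose
        -- value has no constant term.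
        have hne : FreeMonoid.of x * (FreeMonoid.of y * w) ≠ FreeMonoid.of (Sum.inr i) := by
          intro h
          simpa using congrArg FreeMonoid.length h
        simp [commPolynomial, hletter, hne]
  | add p q hp hq => simp [hp, hq]
  | smul r p hp =>
    rw [map_smul, ← algebraMap_smul (Polynomial K) r (commPolynomial A Y K p), Derivation.map_smul,
      map_smul, Algebra.smul_def, map_mul, hp]
    simp [PowerSeries.algebraMap_apply']

variable {A K : Type*} [Fintype A] [CommRing K]

theorem coeff_zero_specialize (f : NCPowerSeries A K) :
    PowerSeries.coeff 0 (specialize f) = coeff [] f := by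
  simp [specialize]

theorem coeff_succ_specialize (f : NCPowerSeries A K) (m : ℕ) :
    PowerSeries.coeff (m + 1) (specialize f) =
      ∑ a, PowerSeries.coeff m (specialize (shift a f)) := by
  simp only [specialize, PowerSeries.coeff_mk]
  rw [← (Fin.consEquiv fun _ => A).sum_comp, Fintype.sum_prod_type]
  refine Finset.sum_congr rfl fun a _ => Finset.sum_congr rfl fun v _ => ?_
  simp [Fin.consEquiv, List.ofFn_succ, coeff_shift]

theorem specialize_add (f g : NCPowerSeries A K) :
    specialize (f + g) = specialize f + specialize g := by
  ext m
  simp [specialize, Finset.sum_add_distrib]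

theorem specialize_smul (c : K) (f : NCPowerSeries A K) :
    specialize (c • f) = c • specialize f := by
  ext m
  simp [specialize, Finset.mul_sum]

theorem specialize_one : specialize (1 : NCPowerSeries A K) = 1 := by
  ext m
  cases m with
  | zero => simp [coeff_zero_specialize]
  | succ m => simp [specialize, List.ofFn_succ, PowerSeries.coeff_one]

theorem specialize_eq (f : NCPowerSeries A K) :
    specialize f =
      PowerSeries.C (coeff [] f) + PowerSeries.X * ∑ a, specialize (shift a f) := by
  ext m
  cases m with
  | zero => simp [coeff_zero_specialize]
  | succ m => simp [coeff_succ_specialize, PowerSeries.coeff_succ_X_mul]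

/-- Induction on the degree: removing a first letter from `f * g` follows `shift_mul`, and
`specialize_eq` splits `f` in the same way. -/
theorem specialize_mul (f g : NCPowerSeries A K) :
    specialize (f * g) = specialize f * specialize g := by
  ext m
  induction m generalizing f with
  | zero => simp [coeff_zero_specialize, PowerSeries.coeff_mul]
  | succ m ih =>
    rw [coeff_succ_specialize]
    simp only [shift_mul, specialize_add, specialize_smul, map_add, ih]
    rw [specialize_eq f, add_mul, map_add, PowerSeries.coeff_C_mul, mul_assoc,
      PowerSeries.coeff_succ_X_mul, Finset.sum_mul, map_sum, coeff_succ_specialize,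
      Finset.sum_add_distrib]
    simp [Finset.mul_sum]

theorem specialize_X (a : A) : specialize (X a : NCPowerSeries A K) = PowerSeries.X := by
  classical
  have hshift : ∀ b, shift b (X a : NCPowerSeries A K) = if b = a then 1 else 0 := by
    intro b
    ext w
    split_ifs with h
    · cases w <;> simp [coeff_shift, X, h]
    · simp [coeff_shift, X, h]
  have h0 : specialize (0 : NCPowerSeries A K) = 0 := by
    ext m
    simp [specialize]
  have hnil : coeff [] (X a : NCPowerSeries A K) = 0 := by simp [X]
  rw [specialize_eq, hnil]
  simp [hshift, apply_ite specialize, h0, specialize_one]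

/-- Setting all variables equal is an algebra homomorphism. -/
noncomputable def specializeHom (A K : Type*) [Fintype A] [CommRing K] :
    NCPowerSeries A K →ₐ[K] PowerSeries K :=
  AlgHom.ofLinearMap
    { toFun := specialize, map_add' := specialize_add, map_smul' := specialize_smul }
    specialize_one specialize_mul

/-- Both sides are algebra homomorphisms in `p` that agree on letters. -/
theorem aeval_commPolynomial {Y : Type*} (s : Y → NCPowerSeries A K) (p : NCPolynomial A Y K) :
    MvPolynomial.aeval (fun j => specialize (s j)) (commPolynomial A Y K p) =
      specialize (evalAt s p) := by
  have : ((MvPolynomial.aeval (R := Polynomial K) fun j => specialize (s j)).restrictScalars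
      K).comp (commPolynomial A Y K) = (specializeHom A K).comp (evalAt s) := by
    refine (MonoidAlgebra.lift K _ (FreeMonoid (A ⊕ Y))).symm.injective ?_
    apply FreeMonoid.hom_eq
    rintro (a | j)
    · simp [commPolynomial, evalAt, specializeHom, specialize_X, PowerSeries.algebraMap_apply']
    · simp [commPolynomial, evalAt, specializeHom]
  exact DFunLike.congr_fun this p

/-- Setting all variables equal maps algebraic series to algebraic series. -/
theorem IsAlgebraic.specialize [IsDomain K] [CharZero K] {f : NCPowerSeries A K}
    (hf : IsAlgebraic f) : _root_.IsAlgebraic (Polynomial K) (specialize f) := by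
  obtain ⟨n, p, s, hp, hs0, hs, j, hj⟩ := hf
  have halg : _root_.IsAlgebraic (Polynomial K) (NCPowerSeries.specialize (s j)) := by
    refine isAlgebraic_of_jacobian_ne_zero
      (fun j => commPolynomial A (Fin n) K (p j) - MvPolynomial.X j)
      (fun j => NCPowerSeries.specialize (s j)) (fun j => ?_) (fun hdet => ?_) j
    · rw [map_sub, aeval_commPolynomial, ← hs, MvPolynomial.aeval_X, sub_self]
    · have h1 := congrArg PowerSeries.constantCoeff hdet
      rw [RingHom.map_det, map_zero] at h1
      -- Properness excludes linear terms in the `y_i`, so the Jacobian of `p_j - y_j` has constant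
      -- term `-1`, the negative identity matrix.
      have h2 : (PowerSeries.constantCoeff (R := K)).mapMatrix (Matrix.of fun j i =>
          MvPolynomial.aeval (fun j => NCPowerSeries.specialize (s j)) (MvPolynomial.pderiv i
            (commPolynomial A (Fin n) K (p j) - MvPolynomial.X j))) = -1 := by
        ext a b
        have h3 := constantCoeff_aeval_pderiv_commPolynomial
          (fun j => NCPowerSeries.specialize (s j))
          (fun j => by
            rw [← PowerSeries.coeff_zero_eq_constantCoeff_apply, coeff_zero_specialize, hs0]) (p a) b
        rw [(hp a).2 b] at h3
        simp only [RingHom.mapMatrix_apply, Matrix.map_apply, Matrix.of_apply, map_sub, h3,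
          MvPolynomial.pderiv_X, Matrix.neg_apply, Matrix.one_apply, Pi.single_apply]
        split_ifs with h <;> simp
      rw [h2, Matrix.det_neg, Matrix.det_one, mul_one] at h1
      exact pow_ne_zero _ (neg_ne_zero.mpr one_ne_zero) h1
  have hc : NCPowerSeries.specialize f =
      NCPowerSeries.specialize (s j) +
        algebraMap (Polynomial K) (PowerSeries K) (Polynomial.C (coeff [] f)) := by
    rw [← hj]
    change specializeHom A K f = specializeHom A K _ + _
    rw [map_sub, AlgHom.commutes]
    simp [PowerSeries.algebraMap_apply']
  rw [hc]
  exact halg.add (isAlgebraic_algebraMap _)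

end NCPowerSeries

/-! ### Removing the rational part: from `f(x, …, x)` to `g(x)` -/

/-- Clears denominators: with `p = 1 - c x` or `p = x` it handles rational series and index shifts.
-/
theorem IsAlgebraic.of_coe_mul {K : Type*} [CommRing K] [IsDomain K] {p : Polynomial K}
    (hp : p ≠ 0) {z : PowerSeries K}
    (h : IsAlgebraic (Polynomial K) ((p : PowerSeries K) * z)) : IsAlgebraic (Polynomial K) z := by
  have hp' : (p : PowerSeries K) ≠ 0 := by simpa using hp
  refine IsAlgebraic.of_mul (mem_nonZeroDivisors_of_ne_zero hp') ?_ h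
  simpa [PowerSeries.algebraMap_apply'] using isAlgebraic_algebraMap (A := PowerSeries K) p

theorem PowerSeries.isAlgebraic_coe {K : Type*} [CommRing K] [IsDomain K] (p : Polynomial K) :
    IsAlgebraic (Polynomial K) (p : PowerSeries K) := by
  simpa [PowerSeries.algebraMap_apply'] using isAlgebraic_algebraMap (A := PowerSeries K) p

theorem PowerSeries.coeff_one_sub_mul {K : Type*} [CommRing K] (c : K) (f : PowerSeries K) (m : ℕ) :
    PowerSeries.coeff m (((1 - Polynomial.C c * Polynomial.X : Polynomial K) : PowerSeries K) * f) =
      PowerSeries.coeff m f - if m = 0 then 0 else c * PowerSeries.coeff (m - 1) f := by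
  have h : ((1 - Polynomial.C c * Polynomial.X : Polynomial K) : PowerSeries K) * f =
      f - PowerSeries.C c * (PowerSeries.X * f) := by
    push_cast
    ring
  rw [h, map_sub, PowerSeries.coeff_C_mul]
  cases m with
  | zero => simp
  | succ m => simp [PowerSeries.coeff_succ_X_mul]

theorem Polynomial.one_sub_C_mul_X_ne_zero {K : Type*} [CommRing K] [Nontrivial K] (c : K) :
    (1 - Polynomial.C c * Polynomial.X : Polynomial K) ≠ 0 := fun h => by
  simpa using congrArg (Polynomial.coeff · 0) h

theorem PowerSeries.isAlgebraic_mk_pow {K : Type*} [CommRing K] [IsDomain K] (c : K) :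
    IsAlgebraic (Polynomial K) (PowerSeries.mk fun m => c ^ m) := by
  refine IsAlgebraic.of_coe_mul (Polynomial.one_sub_C_mul_X_ne_zero c) ?_
  refine (congrArg (IsAlgebraic (Polynomial K)) ?_).mpr 
    (isAlgebraic_one (R := Polynomial K) (A := PowerSeries K))
  ext m
  rw [PowerSeries.coeff_one_sub_mul]
  cases m with
  | zero => simp
  | succ m => simp [PowerSeries.coeff_one, pow_succ, mul_comm]

theorem PowerSeries.isAlgebraic_mk_mul_pow {K : Type*} [CommRing K] [IsDomain K] (c : K) :
    IsAlgebraic (Polynomial K) (PowerSeries.mk fun m => (m : K) * c ^ m) := by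
  refine IsAlgebraic.of_coe_mul (Polynomial.one_sub_C_mul_X_ne_zero c) ?_
  refine (congrArg (IsAlgebraic (Polynomial K)) ?_).mpr 
    ((PowerSeries.isAlgebraic_mk_pow c).sub (isAlgebraic_one (R := Polynomial K)))
  ext m
  rw [PowerSeries.coeff_one_sub_mul]
  cases m with
  | zero => simp
  | succ m =>
    simp [PowerSeries.coeff_one]
    ring

theorem IsAlgebraic.powerSeries_tail {K : Type*} [CommRing K] [IsDomain K] {f : PowerSeries K}
    (hf : IsAlgebraic (Polynomial K) f) :
    IsAlgebraic (Polynomial K) (PowerSeries.mk fun m => PowerSeries.coeff (m + 1) f) := by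
  refine IsAlgebraic.of_coe_mul (p := Polynomial.X) Polynomial.X_ne_zero ?_
  refine (congrArg (IsAlgebraic (Polynomial K)) ?_).mpr
    (hf.sub (PowerSeries.isAlgebraic_coe (Polynomial.C (PowerSeries.coeff 0 f))))
  ext m
  cases m with
  | zero => simp
  | succ m => simp [PowerSeries.coeff_succ_X_mul]

theorem PowerSeries.isAlgebraic_mk_affine_mul_pow {K : Type*} [CommRing K] [IsDomain K]
    (a b c : K) : IsAlgebraic (Polynomial K) (PowerSeries.mk fun m => (a + b * m) * c ^ m) := by
  have h1 := (PowerSeries.isAlgebraic_coe (Polynomial.C a)).mul (PowerSeries.isAlgebraic_mk_pow c)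
  have h2 := (PowerSeries.isAlgebraic_coe (Polynomial.C b)).mul
    (PowerSeries.isAlgebraic_mk_mul_pow c)
  refine (congrArg (IsAlgebraic (Polynomial K)) ?_).mpr (h1.add h2)
  ext m
  simp only [PowerSeries.coeff_mk, map_add, Polynomial.coe_C, PowerSeries.coeff_C_mul]
  ring

theorem coeff_succ_specialize_floorLogSeries {K : Type*} [CommRing K] {k : ℕ} (hk : 2 ≤ k) {α : ℝ}
    (hα : Irrational ((k : ℝ) ^ α)) (m : ℕ) :
    PowerSeries.coeff (m + 1) (NCPowerSeries.specialize (floorLogSeries K k hk α)) =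
      (((k - 1) * ⌊α⌋ + k) + (k - 1) * m) * (k : K) ^ m + 1 + floorPow k α (m + 1) := by
  have h := congrArg (Int.cast : ℤ → K) (sum_floor_add_logb hk hα m)
  rw [floorLogSeries, coeff_specialize_digitSeries, ← Int.cast_sum, h]
  push_cast
  ring

/-- If `f(x, …, x)` is algebraic, so is `∑ m, ⌊-k ^ (m + 1 - frac α)⌋ x ^ m`. -/
theorem isAlgebraic_mk_floorPow {K : Type*} [CommRing K] [IsDomain K] {k : ℕ}
    (hk : 2 ≤ k) {α : ℝ} (hα : Irrational ((k : ℝ) ^ α))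
    (hf : IsAlgebraic (Polynomial K) (NCPowerSeries.specialize (floorLogSeries K k hk α))) :
    IsAlgebraic (Polynomial K) (PowerSeries.mk fun m => (floorPow k α (m + 1) : K)) := by
  refine (congrArg (IsAlgebraic (Polynomial K)) ?_).mpr
    ((hf.powerSeries_tail.sub (PowerSeries.isAlgebraic_mk_affine_mul_pow
      ((k - 1) * ⌊α⌋ + k : K) (k - 1) k)).sub (PowerSeries.isAlgebraic_mk_pow (1 : K)))
  ext m
  simp only [PowerSeries.coeff_mk, map_sub, coeff_succ_specialize_floorLogSeries hk hα, one_pow]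
  ring

/-- If `f(x, …, x)` is algebraic, so is `g(x)`. -/
theorem isAlgebraic_mk_gCoeff {K : Type*} [CommRing K] [IsDomain K] {k : ℕ}
    (hk : 2 ≤ k) {α : ℝ} (hα : Irrational ((k : ℝ) ^ α))
    (hf : IsAlgebraic (Polynomial K) (NCPowerSeries.specialize (floorLogSeries K k hk α))) :
    IsAlgebraic (Polynomial K) (PowerSeries.mk fun m => (gCoeff k α m : K)) := by
  have h0 := isAlgebraic_mk_floorPow hk hα hf
  -- Multiplication by `1 - k x` produces the differences `⌊y_(m+1)⌋ - k⌊y_m⌋`; the leftover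
  -- constant term `⌊y_1⌋` is subtracted because `g` has none.
  have h1 := (PowerSeries.isAlgebraic_coe
    (1 - Polynomial.C (k : K) * Polynomial.X : Polynomial K)).mul h0
  have h2 := h1.sub (PowerSeries.isAlgebraic_coe (Polynomial.C (floorPow k α 1 : K)))
  refine (congrArg (IsAlgebraic (Polynomial K)) (PowerSeries.ext fun m => ?_)).mpr h2
  rw [map_sub, PowerSeries.coeff_one_sub_mul, Polynomial.coe_C, PowerSeries.coeff_C]
  cases m with
  | zero => simp [gCoeff]
  | succ m => simp [gCoeff_eq_floorPow]

/-! ### The main theorem -/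

theorem mainTheorem2 (K : Type*) [CommRing K] [IsDomain K] [CharZero K]
    (k : ℕ) (hk : 2 ≤ k) (α : ℝ) (hα : Irrational ((k : ℝ) ^ α)) :
    ¬ NCPowerSeries.IsAlgebraic (floorLogSeries K k hk α) ∧
    ¬ IsAlgebraic (Polynomial K) (NCPowerSeries.specialize (floorLogSeries K k hk α)) ∧
    (Set.range (gCoeff k α)).Finite ∧
    ¬ EventuallyPeriodic (gCoeff k α) ∧
    ¬ PolynomialRecursive (fun m => (gCoeff k α m : K)) ∧
    ¬ IsAlgebraic (Polynomial K) (PowerSeries.mk fun m => (gCoeff k α m : K)) := by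
  have hfin := finite_range_gCoeff (α := α) hk
  have hper := not_eventuallyPeriodic_gCoeff hk hα
  have hrec : ¬ PolynomialRecursive (fun m => (gCoeff k α m : K)) := by
    intro h
    have hfinK : (Set.range fun m => (gCoeff k α m : K)).Finite := by
      have := hfin.image (Int.cast : ℤ → K)
      rwa [← Set.range_comp] at this
    obtain ⟨N, p, hp, h⟩ := h.eventuallyPeriodic hfinK
    exact hper ⟨N, p, hp, fun n hn => Int.cast_injective (h n hn)⟩
  have halg : ¬ IsAlgebraic (Polynomial K) (PowerSeries.mk fun m => (gCoeff k α m : K)) := by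
    intro h
    refine hrec ?_
    simpa using PolynomialRecursive.of_isAlgebraic h
  have hspec : ¬ IsAlgebraic (Polynomial K)
      (NCPowerSeries.specialize (floorLogSeries K k hk α)) :=
    fun h => halg (isAlgebraic_mk_gCoeff hk hα h)
  exact ⟨fun h => hspec h.specialize, hspec, hfin, hper, hrec, halg⟩
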